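/- Let $k$ be a commutative ring; all algebras are commutative and unital over $k$. Let $\mathbf E$ be a simplicial $k$-algebra that is free in the step-by-step sense: there are sets $X_n$ ($n\ge 0$) of generators $X_n\to E_n$, with $d_i s=0$ for all $s\in X_n$ and $0\le i<n$ (only the last face may be nonzero), such that each $E_n$ is the polynomial $k$-algebra on the degeneracies $\sigma^*s$, where $s\in X_m$ and $\sigma:[n]\twoheadrightarrow[m]$ is a monotone surjection. For $m\ge 0$ let $\mathbf E^{(m)}\subseteq\mathbf E$ be the $m$-skeleton, the simplicial subalgebra generated by the simplices of dimension $\le m$; its generators are the sets $X_n$ with $n\le m$. Assume that $\mathbf E$ is a simplicial resolution of a $k$-algebra $B$: there is a surjective homomorphism $\varepsilon:E_0\to B$ with kernel $d_1(\operatorname{Ker}d_0)$, so that $\pi_0(\mathbf E)\cong B$, and $\pi_n(\mathbf E)=0$ for $n\ge1$. For a simplicial algebra $\mathbf F$ let $NF_n=\bigcap_{i<n}\operatorname{Ker}(d_i:F_n\to F_{n-1})$ be its Moore complex, with differential $\partial_n$ the restriction of $d_n$, and let $D_n\subseteq F_n$ be the subalgebra generated by the degenerate elements. For $n\ge3$ the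 $n$-th term of the 2-crossed complex of $\mathbf F$ is $$\mathbf C^{(2)}(\mathbf F)_n=\frac{NF_n}{(NF_n\cap D_n)+\partial_{n+1}(NF_{n+1}\cap D_{n+1})},$$ on which $F_0$ acts by multiplication through the iterated degeneracy $F_0\to F_n$. Then for every $n\ge 3$: (a) for every $m\ge1$, and in particular for $m=2$, the action of $E_0$ on $\mathbf C^{(2)}(\mathbf E^{(m)})_n$ induces through $\varepsilon$ a $B$-module structure, and this $B$-module is free with basis the classes of the $n$-dimensional generators of $\mathbf E^{(m)}$, that is, of the $s\in X_n$ if $n\le m$, and with empty basis if $n>m$; (b) likewise, $\mathbf C^{(2)}(\mathbf E)_n$ is a free $B$-module with basis the classes of the generators $s\in X_n$. -/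

import Mathlib

open CategoryTheory Opposite Simplicial

universe u v w z

namespace SimplicialAlgebra

variable {k : Type u} [CommRing k] (E : SimplicialObject (CommAlgCat.{v} k))

/-- The algebra of `n`-simplices. -/
abbrev Alg (n : ℕ) : Type v := E.obj (op ⦋n⦌)

/-- The algebra homomorphism `E_m → E_n` induced by a monotone map `[n] → [m]`. -/
def pull {n m : ℕ} (f : ⦋n⦌ ⟶ ⦋m⦌) : Alg E m →ₐ[k] Alg E n := (E.map f.op).hom

/-- The face `d_i : E_{n+1} → E_n`. -/
def face (n : ℕ) (i : Fin (n + 2)) : Alg E (n + 1) →ₐ[k] Alg E n := (E.δ i).hom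

/-- The degeneracy `s_i : E_n → E_{n+1}`. -/
def degen (n : ℕ) (i : Fin (n + 1)) : Alg E n →ₐ[k] Alg E (n + 1) := (E.σ i).hom

/-- The iterated degeneracy `E_0 → E_n`, induced by the unique map `[n] → [0]`. -/
def totalDegen (n : ℕ) : Alg E 0 →ₐ[k] Alg E n := pull E (SimplexCategory.const ⦋n⦌ ⦋0⦌ 0)

/-- The `n`-th term `NE_n = ⋂_{i < n} Ker d_i` of the Moore complex, as an ideal of `E_n`. -/
def moore (n : ℕ) : Ideal (Alg E n) :=
  match n with
  | 0 => ⊤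
  | n + 1 => ⨅ i : Fin (n + 1), RingHom.ker (face E n i.castSucc)

/-- The differential `∂_{n+1}`, which is the restriction of the last face `d_{n+1}`. -/
def lastFace (n : ℕ) : Alg E (n + 1) →ₐ[k] Alg E n := face E n (Fin.last (n + 1))

/-- `D_n`: the subalgebra of `E_n` generated by the degenerate elements `s_i y`. -/
def degenerate (n : ℕ) : Subalgebra k (Alg E n) :=
  match n with
  | 0 => ⊥
  | n + 1 => Algebra.adjoin k {x | ∃ (i : Fin (n + 1)) (y : Alg E n), x = degen E n i y}

/-- `NE_n` as a module over the ground ring. -/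
abbrev mooreModule (n : ℕ) : Submodule k (Alg E n) := (moore E n).restrictScalars k

/-- `∂_{n+1}(NE_{n+1} ∩ D_{n+1})`. -/
def degenerateBoundary (n : ℕ) : Submodule k (Alg E n) :=
  (mooreModule E (n + 1) ⊓ Subalgebra.toSubmodule (degenerate E (n + 1))).map
    (lastFace E n).toLinearMap

/-- The submodule of `E_n` (contained in `NE_n`) by which `NE_n` is divided in order to obtain
the `n`-th term of the 2-crossed complex of `E`. -/
def relations (n : ℕ) : Submodule k (Alg E n) :=
  match n with
  | 0 => ⊥
  | 1 => ⊥
  | 2 => degenerateBoundary E 2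
  | n + 3 => (mooreModule E (n + 3) ⊓ Subalgebra.toSubmodule (degenerate E (n + 3))) ⊔
      degenerateBoundary E (n + 3)

/-- The `n`-th term of the 2-crossed complex of `E`:
`NE_n` for `n = 0, 1`, `NE_2 / ∂_3(NE_3 ∩ D_3)` for `n = 2`, and
`NE_n / ((NE_n ∩ D_n) + ∂_{n+1}(NE_{n+1} ∩ D_{n+1}))` for `n ≥ 3`. -/
abbrev TwoCrossedTerm (n : ℕ) : Type v :=
  (mooreModule E n) ⧸ (relations E n).comap (mooreModule E n).subtype

/-- The class in the `n`-th term of the 2-crossed complex of an element of `NE_n`. -/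
def termMk (n : ℕ) (x : moore E n) : TwoCrossedTerm E n :=
  Submodule.Quotient.mk (p := (relations E n).comap (mooreModule E n).subtype) x

/-- `E_0` acts on `NE_n` by multiplication through the iterated degeneracy `E_0 → E_n`. -/
def mooreAct (n : ℕ) (r : Alg E 0) (x : moore E n) : moore E n :=
  ⟨totalDegen E n r * x.1, (moore E n).mul_mem_left _ x.2⟩

/-- Let `ε : E_0 → B` be an algebra homomorphism (it is surjective in the applications).
The action of `E_0` on `NE_n` induces, through `ε`, a `B`-module structure on the `n`-th term of
the 2-crossed complex of `E`, and this `B`-module is free with basis the classes of the `v i`. -/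
def IsFreeTermOn {B : Type w} [CommRing B] [Algebra k B] (ε : Alg E 0 →ₐ[k] B) (n : ℕ)
    {ι : Type z} (v : ι → moore E n) : Prop :=
  ∃ _ : Module B (TwoCrossedTerm E n),
    (∀ (r : Alg E 0) (x : moore E n), ε r • termMk E n x = termMk E n (mooreAct E n r x)) ∧
    ∃ b : Module.Basis ι B (TwoCrossedTerm E n), ∀ i, b i = termMk E n (v i)

/-- Construction data exhibiting `E` as a free simplicial algebra in the step-by-step sense:
sets `gen n` of non-degenerate generators in each dimension `n`, all of whose faces except the
last one vanish, such that each `E_n` is the polynomial algebra over the ground ring on the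
degeneracies `σ^* s` of the generators (`s ∈ gen m`, `σ : [n] ↠ [m]`). -/
structure ConstructionData where
  gen : ℕ → Type z
  elt : ∀ n, gen n → Alg E n
  face_elt : ∀ (n : ℕ) (s : gen (n + 1)) (i : Fin (n + 1)),
    face E n i.castSucc (elt (n + 1) s) = 0
  free : ∀ n : ℕ, Function.Bijective
    (MvPolynomial.aeval (R := k)
      (fun p : (Σ m : ℕ, {f : ⦋n⦌ ⟶ ⦋m⦌ // Epi f} × gen m) =>
        pull E p.2.1.1 (elt p.1 p.2.2)))

variable {E} in
lemma ConstructionData.elt_mem_moore (X : ConstructionData.{u, v, z} E) (n : ℕ) (s : X.gen n) :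
    X.elt n s ∈ moore E n := by
  cases n with
  | zero => exact Submodule.mem_top
  | succ n => exact (Submodule.mem_iInf _).2 fun i => X.face_elt n s i

variable {E} in
/-- The generators in dimension `n`, as elements of `NE_n`. -/
def ConstructionData.mooreElt (X : ConstructionData.{u, v, z} E) (n : ℕ) (s : X.gen n) :
    moore E n := ⟨X.elt n s, X.elt_mem_moore n s⟩

/-- The augmentation `ε : E_0 → B` makes `E` a simplicial resolution of `B` (for a free simplicial
algebra `E`): `ε` induces `π_0(E) ≅ B`, and `π_n(E) = 0` for `n ≥ 1`. -/
structure IsResolution {B : Type w} [CommRing B] [Algebra k B] (ε : Alg E 0 →ₐ[k] B) : Prop where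
  surjective : Function.Surjective ε
  ker_eq : ∀ r : Alg E 0, ε r = 0 ↔ ∃ x ∈ moore E 1, lastFace E 0 x = r
  acyclic : ∀ (n : ℕ), ∀ x ∈ moore E (n + 1), lastFace E n x = 0 →
    ∃ y ∈ moore E (n + 2), lastFace E (n + 1) y = x

/-- The algebra of `n`-simplices of the `m`-skeleton: the subalgebra of `E_n` generated by the
images of all the simplices of dimension at most `m`. -/
def skelAlg (m n : ℕ) : Subalgebra k (Alg E n) :=
  Algebra.adjoin k {x | ∃ (j : ℕ) (_ : j ≤ m) (f : ⦋n⦌ ⟶ ⦋j⦌) (y : Alg E j), x = pull E f y}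

lemma pull_comp {a b c : ℕ} (f : ⦋a⦌ ⟶ ⦋b⦌) (g : ⦋b⦌ ⟶ ⦋c⦌) (x : Alg E c) :
    pull E f (pull E g x) = pull E (f ≫ g) x := by
  simp [pull]

lemma pull_id {a : ℕ} (x : Alg E a) : pull E (𝟙 ⦋a⦌) x = x := by
  simp [pull]

lemma skelAlg_le (m : ℕ) {a b : ℕ} (f : ⦋a⦌ ⟶ ⦋b⦌) :
    skelAlg E m b ≤ (skelAlg E m a).comap (pull E f) := by
  refine Algebra.adjoin_le ?_
  rintro x ⟨j, hj, g, y, rfl⟩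
  refine Algebra.subset_adjoin ⟨j, hj, f ≫ g, y, pull_comp E f g y⟩

/-- The structure maps of the `m`-skeleton. -/
def skelMap (m : ℕ) {a b : ℕ} (f : ⦋a⦌ ⟶ ⦋b⦌) : skelAlg E m b →ₐ[k] skelAlg E m a :=
  ((pull E f).comp (skelAlg E m b).val).codRestrict (skelAlg E m a)
    fun x => skelAlg_le E m f x.2

/-- The `m`-skeleton `E^(m)` of a free simplicial algebra `E`, as a simplicial subalgebra of `E`:
it is generated by the simplices of dimension at most `m`. -/
def skel (m : ℕ) : SimplicialObject (CommAlgCat.{v} k) where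
  obj a := CommAlgCat.of k (skelAlg E m a.unop.len)
  map f := CommAlgCat.ofHom (skelMap E m f.unop)
  map_id a := by
    refine CommAlgCat.hom_ext (AlgHom.ext fun x => Subtype.ext ?_)
    exact pull_id E x.1
  map_comp f g := by
    refine CommAlgCat.hom_ext (AlgHom.ext fun x => Subtype.ext ?_)
    exact (pull_comp E g.unop f.unop x.1).symm

/-- The inclusion of the `m`-skeleton. -/
def skelIncl (m n : ℕ) : Alg (skel E m) n →ₐ[k] Alg E n := (skelAlg E m n).val

variable {E} in
/-- The generators of dimension `n` lying in the `m`-skeleton (that is, all of them if `n ≤ m`,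
and none otherwise), as elements of the Moore complex of the `m`-skeleton. -/
def ConstructionData.skelElt (X : ConstructionData.{u, v, z} E) (m n : ℕ)
    (s : {_s : X.gen n // n ≤ m}) : moore (skel E m) n :=
  ⟨(⟨X.elt n s.1, Algebra.subset_adjoin ⟨n, s.2, 𝟙 _, X.elt n s.1, (pull_id E _).symm⟩⟩ :
      skelAlg E m n), by
    obtain ⟨s, hs⟩ := s
    cases n with
    | zero => exact Submodule.mem_top
    | succ n => exact (Submodule.mem_iInf _).2 fun i => Subtype.ext (X.face_elt n s i)⟩

end SimplicialAlgebra

/-!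
Let `x ∈ NE_n` and let `T` be the alternating sum of the degeneracies. If `u ∈ D_{n+1}` has a
degenerate last face, then `T (d_0 u * x) - u * T x` lies in `NE_{n+1} ∩ D_{n+1}`, and modulo
`D_n` its last face is `± (d_0 u - d_{n+1} u) * x`. Taking `u = s_0 e` shows that, modulo the
relations, `e ∈ E_n` acts on `NE_n` through its restriction to the initial vertex; taking for `u`
a degeneracy of `y ∈ NE_1` shows that `∂ y` acts as zero. Hence the action of `E_0` factors
through `B`. As `E_n` is generated by `D_n` and the generators `s ∈ X_n`, every element of `NE_n`
is, modulo `NE_n ∩ D_n`, an `E_n`-linear combination of the generators, whose classes therefore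
span over `B`.

For linear independence, let `c_s : E_n → B` be the augmentation of the partial derivative with
respect to `s`; it is a derivation that kills `D_n`. The alternating sum of the `c_s ∘ d_j` is a
derivation that kills each `s_i y`, hence all of `D_{n+1}`, and it agrees with `± c_s ∘ ∂` on
`NE_{n+1}`. So `c_s` kills the relations, and the `c_s` induce coordinate functionals.

Finally, the skeleton is free on the generators of dimension at most `m` and has the same `π_0`
as `E` when `m ≥ 1`, so (a) is (b) for the skeleton.
-/

namespace SimplicialAlgebra

section SimplicialIdentities

variable {k : Type u} [CommRing k] {E : SimplicialObject (CommAlgCat.{v} k)}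

lemma face_degen_self (n : ℕ) (i : Fin (n + 1)) (x : Alg E n) :
    face E n i.castSucc (degen E n i x) = x :=
  congr($(E.δ_comp_σ_self (i := i)).hom x)

lemma face_degen_succ (n : ℕ) (i : Fin (n + 1)) (x : Alg E n) :
    face E n i.succ (degen E n i x) = x :=
  congr($(E.δ_comp_σ_succ (i := i)).hom x)

lemma face_degen_of_le {n : ℕ} {i : Fin (n + 2)} {j : Fin (n + 1)} (h : i ≤ j.castSucc)
    (x : Alg E (n + 1)) :
    face E (n + 1) i.castSucc (degen E (n + 1) j.succ x) = degen E n j (face E n i x) :=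
  congr($(E.δ_comp_σ_of_le h).hom x)

lemma face_degen_of_gt {n : ℕ} {i : Fin (n + 2)} {j : Fin (n + 1)} (h : j.castSucc < i)
    (x : Alg E (n + 1)) :
    face E (n + 1) i.succ (degen E (n + 1) j.castSucc x) = degen E n j (face E n i x) :=
  congr($(E.δ_comp_σ_of_gt h).hom x)

lemma exists_face_degen_eq {n : ℕ} {i : Fin (n + 2)} {j : Fin (n + 3)} (hself : j ≠ i.castSucc)
    (hsucc : j ≠ i.succ) : ∃ (i' : Fin (n + 1)) (j' : Fin (n + 2)),
      (j ≠ Fin.last _ → j' ≠ Fin.last _) ∧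
      ∀ x, face E (n + 1) j (degen E (n + 1) i x) = degen E n i' (face E n j' x) := by
  rcases lt_or_gt_of_ne hself with hij | hij
  · obtain ⟨i, rfl⟩ := Fin.exists_succ_eq.2 fun h : i = 0 => by simp [h] at hij
    obtain ⟨j, rfl⟩ := Fin.exists_castSucc_eq.2 (Fin.ne_last_of_lt hij)
    have hji : j < i.succ := Fin.castSucc_lt_castSucc_iff.1 hij
    exact ⟨i, j, fun _ => Fin.ne_last_of_lt hji, face_degen_of_le (Fin.le_castSucc_iff.2 hji)⟩
  · have hij' : i.succ < j := lt_of_le_of_ne (Fin.castSucc_lt_iff_succ_le.1 hij) hsucc.symm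
    obtain ⟨j, rfl⟩ := Fin.exists_succ_eq.2 (Fin.ne_zero_of_lt hij')
    have hji : i < j := Fin.succ_lt_succ_iff.1 hij'
    obtain ⟨i, rfl⟩ := Fin.exists_castSucc_eq.2 (Fin.ne_last_of_lt hji)
    exact ⟨i, j, fun hj h => hj (h ▸ Fin.succ_last _), face_degen_of_gt hji⟩

lemma face_face {n : ℕ} {i j : Fin (n + 2)} (h : i ≤ j) (x : Alg E (n + 2)) :
    face E n i (face E (n + 1) j.succ x) = face E n j (face E (n + 1) i.castSucc x) :=
  congr($(E.δ_comp_δ h).hom x)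

lemma lastFace_degen_castSucc {n : ℕ} (i : Fin (n + 1)) (x : Alg E (n + 1)) :
    lastFace E (n + 1) (degen E (n + 1) i.castSucc x) = degen E n i (lastFace E n x) :=
  face_degen_of_gt (Fin.castSucc_lt_last i) x

lemma lastFace_degen_last (n : ℕ) (x : Alg E n) :
    lastFace E n (degen E n (Fin.last n) x) = x :=
  face_degen_succ n (Fin.last n) x

lemma mem_moore_succ {n : ℕ} {x : Alg E (n + 1)} :
    x ∈ moore E (n + 1) ↔ ∀ i : Fin (n + 1), face E n i.castSucc x = 0 :=
  Submodule.mem_iInf _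

lemma face_degen_eq_zero {n : ℕ} {x : Alg E (n + 1)} (hx : x ∈ moore E (n + 1))
    {i j : Fin (n + 2)} (hself : j.castSucc ≠ i.castSucc) (hsucc : j.castSucc ≠ i.succ) :
    face E (n + 1) j.castSucc (degen E (n + 1) i x) = 0 := by
  obtain ⟨i', j', hj', hface⟩ := exists_face_degen_eq (E := E) hself hsucc
  obtain ⟨l, rfl⟩ := Fin.exists_castSucc_eq.2 (hj' (Fin.castSucc_lt_last j).ne)
  rw [hface, mem_moore_succ.1 hx, map_zero]

lemma lastFace_mem_moore {n : ℕ} {x : Alg E (n + 1)} (hx : x ∈ moore E (n + 1)) :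
    lastFace E n x ∈ moore E n := by
  cases n with
  | zero => exact Submodule.mem_top
  | succ n =>
    refine mem_moore_succ.2 fun i => ?_
    rw [lastFace, ← Fin.succ_last, face_face (Fin.le_last _), mem_moore_succ.1 hx, map_zero]

lemma degen_mem_degenerate (n : ℕ) (i : Fin (n + 1)) (x : Alg E n) :
    degen E n i x ∈ degenerate E (n + 1) :=
  Algebra.subset_adjoin ⟨i, x, rfl⟩

lemma face_degen_mem_degenerate {n : ℕ} {i : Fin (n + 2)} {j : Fin (n + 3)}
    (hself : j ≠ i.castSucc) (hsucc : j ≠ i.succ) (x : Alg E (n + 1)) :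
    face E (n + 1) j (degen E (n + 1) i x) ∈ degenerate E (n + 1) := by
  obtain ⟨i', j', -, hface⟩ := exists_face_degen_eq (E := E) hself hsucc
  exact hface x ▸ degen_mem_degenerate n i' _

lemma pull_mem_degenerate {n m : ℕ} (h : m < n) (f : ⦋n⦌ ⟶ ⦋m⦌) (x : Alg E m) :
    pull E f x ∈ degenerate E n := by
  obtain _ | n := n
  · omega
  have hf : ¬ Function.Injective f.toOrderHom := fun hf => by
    have : n + 2 ≤ m + 1 := by simpa using Fintype.card_le_of_injective _ hf
    omega
  obtain ⟨i, g, rfl⟩ := SimplexCategory.eq_σ_comp_of_not_injective f hf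
  rw [← pull_comp]
  exact degen_mem_degenerate n i _

end SimplicialIdentities

section CrossedRelations

variable {k : Type u} [CommRing k] (E : SimplicialObject (CommAlgCat.{v} k))

/-- The relations `(NE_n ∩ D_n) + ∂_{n+1}(NE_{n+1} ∩ D_{n+1})` of the crossed complex of `E`,
written uniformly in `n`; the 2-crossed complex has the same relations from degree `3` on. -/
def crossedRelations (n : ℕ) : Submodule k (Alg E n) :=
  (mooreModule E n ⊓ Subalgebra.toSubmodule (degenerate E n)) ⊔ degenerateBoundary E n

lemma relations_eq_crossedRelations {n : ℕ} (hn : 3 ≤ n) :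
    relations E n = crossedRelations E n := by
  obtain ⟨n, rfl⟩ := Nat.exists_eq_add_of_le' hn
  rfl

variable {E}

lemma mem_crossedRelations_of_mem_degenerate {n : ℕ} {x : Alg E n} (hx : x ∈ moore E n)
    (hxD : x ∈ degenerate E n) : x ∈ crossedRelations E n :=
  Submodule.mem_sup_left ⟨hx, hxD⟩

lemma lastFace_mem_crossedRelations {n : ℕ} {x : Alg E (n + 1)} (hx : x ∈ moore E (n + 1))
    (hxD : x ∈ degenerate E (n + 1)) : lastFace E n x ∈ crossedRelations E n :=
  Submodule.mem_sup_right ⟨x, ⟨hx, hxD⟩, rfl⟩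

lemma mem_crossedRelations_of_lastFace_eq {n : ℕ} {x y : Alg E n} {w : Alg E (n + 1)} (c : kˣ)
    (hw : w ∈ moore E (n + 1)) (hwD : w ∈ degenerate E (n + 1)) (hx : x ∈ moore E n)
    (hy : y ∈ degenerate E n) (hwxy : lastFace E n w = y + c • x) :
    x ∈ crossedRelations E n := by
  have hcx : c • x ∈ moore E n := Submodule.smul_of_tower_mem _ c hx
  have hy_moore : y ∈ moore E n := by
    rw [← add_sub_cancel_right y (c • x), ← hwxy]
    exact sub_mem (lastFace_mem_moore hw) hcx
  have hcx_rel : c • x ∈ crossedRelations E n := by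
    rw [← add_sub_cancel_left y (c • x), ← hwxy]
    exact sub_mem (lastFace_mem_crossedRelations hw hwD)
      (mem_crossedRelations_of_mem_degenerate hy_moore hy)
  exact (Submodule.smul_mem_iff_of_isUnit _ c.isUnit).1 hcx_rel

end CrossedRelations

section AlternatingDegeneracy

variable {k : Type u} [CommRing k] {E : SimplicialObject (CommAlgCat.{v} k)}

variable (E) in
/-- The alternating sum `∑ i, (-1)^i s_i` of the degeneracies. On the Moore complex it is a
section of `d_0` that is killed by all the other faces except the last one. -/
def altDegen (n : ℕ) : Alg E n →ₗ[k] Alg E (n + 1) :=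
  ∑ i : Fin (n + 1), (-1 : k) ^ (i : ℕ) • (degen E n i).toLinearMap

lemma altDegen_apply (n : ℕ) (x : Alg E n) :
    altDegen E n x = ∑ i : Fin (n + 1), (-1 : k) ^ (i : ℕ) • degen E n i x := by
  simp [altDegen]

lemma altDegen_mem_degenerate (n : ℕ) (x : Alg E n) :
    altDegen E n x ∈ degenerate E (n + 1) := by
  rw [altDegen_apply]
  exact Subalgebra.sum_mem _ fun i _ => Subalgebra.smul_mem _ (degen_mem_degenerate n i x) _

lemma lastFace_altDegen (n : ℕ) (x : Alg E (n + 1)) :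
    lastFace E (n + 1) (altDegen E (n + 1) x) =
      altDegen E n (lastFace E n x) + (-1 : k) ^ (n + 1) • x := by
  simp only [altDegen_apply, map_add, map_sum, map_smul, Fin.sum_univ_castSucc (n := n + 1),
    lastFace_degen_castSucc, lastFace_degen_last, Fin.val_castSucc, Fin.val_last]

lemma face_zero_altDegen {n : ℕ} {x : Alg E (n + 1)} (hx : x ∈ moore E (n + 1)) :
    face E (n + 1) 0 (altDegen E (n + 1) x) = x := by
  have hface (i : Fin (n + 1)) : face E (n + 1) 0 (degen E (n + 1) i.succ x) = 0 :=
    face_degen_eq_zero (j := 0) hx (Fin.castSucc_injective _ |>.ne (Fin.succ_ne_zero i).symm)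
      (Fin.succ_ne_zero i.succ).symm
  have hzero : face E (n + 1) 0 (degen E (n + 1) 0 x) = x := face_degen_self (n + 1) 0 x
  simp [altDegen_apply, Fin.sum_univ_succ (n := n + 1), hface, hzero]

lemma face_succ_altDegen {n : ℕ} {x : Alg E (n + 1)} (hx : x ∈ moore E (n + 1))
    (j : Fin (n + 1)) : face E (n + 1) j.succ.castSucc (altDegen E (n + 1) x) = 0 := by
  have hface (i : Fin (n + 2)) (hi : i ≠ j.castSucc ∧ i ≠ j.succ) :
      face E (n + 1) j.succ.castSucc (degen E (n + 1) i x) = 0 :=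
    face_degen_eq_zero hx (Fin.castSucc_injective _ |>.ne hi.2.symm)
      (Fin.succ_injective _ |>.ne hi.1.symm)
  have hself : face E (n + 1) j.succ.castSucc (degen E (n + 1) j.succ x) = x :=
    face_degen_self (n + 1) j.succ x
  have hsucc : face E (n + 1) j.succ.castSucc (degen E (n + 1) j.castSucc x) = x :=
    face_degen_succ (n + 1) j.castSucc x
  rw [altDegen_apply, map_sum, Fintype.sum_eq_add j.castSucc j.succ Fin.castSucc_lt_succ.ne
    fun i hi => by rw [map_smul, hface i hi, smul_zero]]
  rw [map_smul, map_smul, hself, hsucc, Fin.val_castSucc, Fin.val_succ, ← add_smul, pow_succ]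
  simp

end AlternatingDegeneracy

section ActionModuloRelations

variable {k : Type u} [CommRing k] {E : SimplicialObject (CommAlgCat.{v} k)}

/-- The endomorphism `v ↦ max (v - j) 0` of `[n]`. -/
def truncShift (n j : ℕ) : ⦋n⦌ ⟶ ⦋n⦌ :=
  SimplexCategory.mkHom ⟨fun v => ⟨v - j, by omega⟩,
    fun _ _ h => Fin.mk_le_mk.2 (Nat.sub_le_sub_right h j)⟩

lemma truncShift_zero (n : ℕ) : truncShift n 0 = 𝟙 _ := rfl

lemma truncShift_self (n : ℕ) : truncShift n n = SimplexCategory.const ⦋n⦌ ⦋n⦌ 0 := by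
  ext v : 3
  exact Fin.ext (Nat.sub_eq_zero_of_le (Nat.lt_succ_iff.1 v.2))

lemma σ_zero_comp_δ_last (n : ℕ) :
    SimplexCategory.σ 0 ≫ SimplexCategory.δ (Fin.last (n + 1)) = truncShift (n + 1) 1 := by
  ext v : 3
  change (Fin.last (n + 1)).succAbove (Fin.predAbove 0 v) = _
  rw [Fin.succAbove_last]
  induction v using Fin.cases with
  | zero => rfl
  | succ v => rw [Fin.predAbove_zero_succ]; rfl

lemma truncShift_comp_truncShift (n i j : ℕ) :
    truncShift n i ≫ truncShift n j = truncShift n (i + j) := by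
  ext v : 3
  exact Fin.ext (Nat.sub_sub v i j)

/-- The restriction `E_n → E_0` to the initial vertex. -/
def vertex (E : SimplicialObject (CommAlgCat.{v} k)) (n : ℕ) : Alg E n →ₐ[k] Alg E 0 :=
  pull E (SimplexCategory.const ⦋0⦌ ⦋n⦌ 0)

lemma totalDegen_vertex (n : ℕ) (e : Alg E n) :
    totalDegen E n (vertex E n e) = pull E (SimplexCategory.const ⦋n⦌ ⦋n⦌ 0) e := by
  rw [totalDegen, vertex, pull_comp, SimplexCategory.const_comp]
  rfl

/-- The relation is the last face of `T(d_0 u * x) - u * T x`, where `T` is the alternating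
degeneracy. -/
lemma face_zero_sub_lastFace_mul_mem_crossedRelations {n : ℕ} {u : Alg E (n + 2)}
    (hu : u ∈ degenerate E (n + 2)) (hu_last : lastFace E (n + 1) u ∈ degenerate E (n + 1))
    {x : Alg E (n + 1)} (hx : x ∈ moore E (n + 1)) :
    (face E (n + 1) 0 u - lastFace E (n + 1) u) * x ∈ crossedRelations E (n + 1) := by
  set e := face E (n + 1) 0 u
  have hex : e * x ∈ moore E (n + 1) := Ideal.mul_mem_left _ e hx
  set w := altDegen E (n + 1) (e * x) - u * altDegen E (n + 1) x with hw_def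
  have hw : w ∈ moore E (n + 2) := by
    refine mem_moore_succ.2 fun i => ?_
    rw [hw_def, map_sub, map_mul (face E (n + 1) _)]
    induction i using Fin.cases with
    | zero => rw [Fin.castSucc_zero, face_zero_altDegen hex, face_zero_altDegen hx, sub_self]
    | succ i => rw [face_succ_altDegen hex, face_succ_altDegen hx, mul_zero, sub_zero]
  have hwD : w ∈ degenerate E (n + 2) :=
    sub_mem (altDegen_mem_degenerate _ _) (mul_mem hu (altDegen_mem_degenerate _ _))
  refine mem_crossedRelations_of_lastFace_eq ((-1) ^ (n + 1)) hw hwD (Ideal.mul_mem_left _ _ hx)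
    (sub_mem (altDegen_mem_degenerate n (lastFace E n (e * x)))
      (mul_mem hu_last (altDegen_mem_degenerate n (lastFace E n x)))) ?_
  rw [hw_def, map_sub, map_mul (lastFace E (n + 1)), lastFace_altDegen, lastFace_altDegen,
    Units.smul_def, Units.val_pow_eq_pow_val, Units.val_neg, Units.val_one, mul_add, sub_mul,
    smul_sub, mul_smul_comm]
  abel

lemma sub_degen_zero_lastFace_mul_mem_crossedRelations {n : ℕ} (e : Alg E (n + 1))
    {x : Alg E (n + 1)} (hx : x ∈ moore E (n + 1)) :
    (e - degen E n 0 (lastFace E n e)) * x ∈ crossedRelations E (n + 1) := by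
  have hlast : lastFace E (n + 1) (degen E (n + 1) 0 e) = degen E n 0 (lastFace E n e) :=
    lastFace_degen_castSucc 0 e
  have hzero : face E (n + 1) 0 (degen E (n + 1) 0 e) = e := face_degen_self (n + 1) 0 e
  simpa only [hzero, hlast] using face_zero_sub_lastFace_mul_mem_crossedRelations
    (degen_mem_degenerate (n + 1) 0 e) (hlast ▸ degen_mem_degenerate n 0 _) hx

/-- Iterating `e ↦ s_0 d_n e` moves every vertex of `e` to the initial one. -/
theorem sub_totalDegen_vertex_mul_mem_crossedRelations {n : ℕ} (e : Alg E (n + 1))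
    {x : Alg E (n + 1)} (hx : x ∈ moore E (n + 1)) :
    (e - totalDegen E (n + 1) (vertex E (n + 1) e)) * x ∈ crossedRelations E (n + 1) := by
  have hshift (j : ℕ) :
      (e - pull E (truncShift (n + 1) j) e) * x ∈ crossedRelations E (n + 1) := by
    induction j with
    | zero => simp [truncShift_zero, pull_id]
    | succ j ih =>
      have hstep := sub_degen_zero_lastFace_mul_mem_crossedRelations
        (pull E (truncShift (n + 1) j) e) hx
      have hpull : degen E n 0 (lastFace E n (pull E (truncShift (n + 1) j) e)) =
          pull E (truncShift (n + 1) (j + 1)) e := by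
        rw [add_comm j, ← truncShift_comp_truncShift, ← σ_zero_comp_δ_last, ← pull_comp,
          ← pull_comp]
        rfl
      rw [hpull] at hstep
      simpa [← add_mul] using add_mem ih hstep
  rw [totalDegen_vertex, ← truncShift_self]
  exact hshift (n + 1)

/-- The map `[n] → [1]` that sends `0` to `0` and every other vertex to `1`. -/
def pinch (n : ℕ) : ⦋n⦌ ⟶ ⦋1⦌ :=
  SimplexCategory.mkHom ⟨fun v => if v = 0 then 0 else 1, by
    intro v w h
    dsimp only
    split_ifs with hv hw <;> simp_all⟩

lemma face_zero_pull_pinch {n : ℕ} {y : Alg E 1} (hy : y ∈ moore E 1) :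
    face E n 0 (pull E (pinch (n + 1)) y) = 0 := by
  have hδ : SimplexCategory.δ 0 ≫ pinch (n + 1) =
      SimplexCategory.const ⦋n⦌ ⦋0⦌ 0 ≫ SimplexCategory.δ 0 := by
    ext v : 3
    exact if_neg (t := (0 : Fin 2)) (Fin.succ_ne_zero v)
  have hface : pull E (SimplexCategory.δ 0) y = 0 := mem_moore_succ.1 hy 0
  change pull E (SimplexCategory.δ 0) _ = 0
  rw [pull_comp, hδ, ← pull_comp, hface, map_zero]

lemma lastFace_pull_pinch (n : ℕ) (y : Alg E 1) :
    lastFace E (n + 1) (pull E (pinch (n + 2)) y) = pull E (pinch (n + 1)) y := by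
  have hδ : SimplexCategory.δ (Fin.last (n + 2)) ≫ pinch (n + 2) = pinch (n + 1) := by
    ext v : 3
    refine if_congr (Iff.trans ?_ Fin.castSucc_eq_zero_iff) rfl rfl
    change (Fin.last (n + 2)).succAbove v = 0 ↔ _
    rw [Fin.succAbove_last]
  change pull E (SimplexCategory.δ _) _ = _
  rw [pull_comp, hδ]

lemma vertex_pull_pinch (n : ℕ) (y : Alg E 1) :
    vertex E (n + 1) (pull E (pinch (n + 1)) y) = lastFace E 0 y := by
  rw [vertex, pull_comp]
  congr 2
  ext v : 3
  fin_cases v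
  rfl

lemma pull_pinch_mul_mem_crossedRelations {n : ℕ} {y : Alg E 1} (hy : y ∈ moore E 1)
    {x : Alg E (n + 2)} (hx : x ∈ moore E (n + 2)) :
    pull E (pinch (n + 2)) y * x ∈ crossedRelations E (n + 2) := by
  have hlast := lastFace_pull_pinch (n + 1) y
  have hmem := face_zero_sub_lastFace_mul_mem_crossedRelations
    (pull_mem_degenerate (by omega) (pinch (n + 3)) y)
    (hlast ▸ pull_mem_degenerate (by omega) (pinch (n + 2)) y) hx
  rw [face_zero_pull_pinch hy, hlast, zero_sub, neg_mul] at hmem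
  exact neg_mem_iff.1 hmem

theorem totalDegen_lastFace_mul_mem_crossedRelations {n : ℕ} {y : Alg E 1} (hy : y ∈ moore E 1)
    {x : Alg E (n + 2)} (hx : x ∈ moore E (n + 2)) :
    totalDegen E (n + 2) (lastFace E 0 y) * x ∈ crossedRelations E (n + 2) := by
  have hsub := sub_totalDegen_vertex_mul_mem_crossedRelations (pull E (pinch (n + 2)) y) hx
  rw [vertex_pull_pinch] at hsub
  simpa [← sub_mul] using sub_mem (pull_pinch_mul_mem_crossedRelations hy hx) hsub

end ActionModuloRelations

section Augmentation

variable {k : Type u} [CommRing k] {E : SimplicialObject (CommAlgCat.{v} k)}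
  {B : Type w} [CommRing B] [Algebra k B] {ε : Alg E 0 →ₐ[k] B}

variable (E ε) in
/-- The homomorphism `ε` exhibits `B` as `π_0(E)`. -/
structure IsPiZero : Prop where
  surjective : Function.Surjective ε
  ker_eq : ∀ r : Alg E 0, ε r = 0 ↔ ∃ x ∈ moore E 1, lastFace E 0 x = r

lemma IsResolution.isPiZero (hE : IsResolution E ε) : IsPiZero E ε :=
  ⟨hE.surjective, hE.ker_eq⟩

variable (ε) in
/-- The augmentation `E_n → B` obtained by restricting to the initial vertex. -/
def aug (n : ℕ) : Alg E n →ₐ[k] B := ε.comp (vertex E n)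

lemma aug_zero (r : Alg E 0) : aug ε 0 r = ε r := by
  rw [aug, AlgHom.comp_apply, vertex, SimplexCategory.const_eq_id, pull_id]

lemma IsPiZero.apply_face_zero (hε : IsPiZero E ε) (z : Alg E 1) :
    ε (face E 0 0 z) = ε (lastFace E 0 z) := by
  have hself : face E 0 0 (degen E 0 0 (face E 0 0 z)) = face E 0 0 z :=
    face_degen_self 0 0 _
  have hlast : lastFace E 0 (degen E 0 0 (face E 0 0 z)) = face E 0 0 z :=
    lastFace_degen_last 0 _
  have hmoore : degen E 0 0 (face E 0 0 z) - z ∈ moore E 1 := by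
    refine mem_moore_succ.2 fun i => ?_
    rw [Fin.fin_one_eq_zero i, Fin.castSucc_zero, map_sub, hself, sub_self]
  rw [← sub_eq_zero, ← map_sub, hε.ker_eq]
  exact ⟨_, hmoore, by rw [map_sub, hlast]⟩

lemma IsPiZero.apply_pull_const (hε : IsPiZero E ε) {n : ℕ} (v : Fin (n + 1)) (x : Alg E n) :
    ε (pull E (SimplexCategory.const ⦋0⦌ ⦋n⦌ v) x) = aug ε n x := by
  have hzero : SimplexCategory.δ 0 ≫ SimplexCategory.mkOfLe 0 v (Fin.zero_le v) =
      SimplexCategory.const ⦋0⦌ ⦋n⦌ v := SimplexCategory.Hom.ext_zero_left _ _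
  have hlast : SimplexCategory.δ 1 ≫ SimplexCategory.mkOfLe 0 v (Fin.zero_le v) =
      SimplexCategory.const ⦋0⦌ ⦋n⦌ 0 := SimplexCategory.Hom.ext_zero_left _ _
  rw [aug, AlgHom.comp_apply, vertex, ← hzero, ← hlast, ← pull_comp, ← pull_comp]
  exact hε.apply_face_zero _

lemma IsPiZero.aug_pull (hε : IsPiZero E ε) {n m : ℕ} (f : ⦋n⦌ ⟶ ⦋m⦌) (x : Alg E m) :
    aug ε n (pull E f x) = aug ε m x := by
  rw [← hε.apply_pull_const (f.toOrderHom 0), aug, AlgHom.comp_apply, vertex, pull_comp,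
    SimplexCategory.const_comp]

lemma IsPiZero.aug_face (hε : IsPiZero E ε) (n : ℕ) (i : Fin (n + 2)) (x : Alg E (n + 1)) :
    aug ε n (face E n i x) = aug ε (n + 1) x :=
  hε.aug_pull (SimplexCategory.δ i) x

lemma IsPiZero.aug_totalDegen (hε : IsPiZero E ε) (n : ℕ) (r : Alg E 0) :
    aug ε n (totalDegen E n r) = ε r := by
  rw [totalDegen, hε.aug_pull, aug_zero]

lemma IsPiZero.aug_eq_zero_of_mem_moore (hε : IsPiZero E ε) {n : ℕ} {x : Alg E (n + 1)}
    (hx : x ∈ moore E (n + 1)) : aug ε (n + 1) x = 0 := by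
  rw [← hε.aug_face n (Fin.castSucc 0), mem_moore_succ.1 hx, map_zero]

end Augmentation

section DerivationAlong

variable {k : Type*} [CommRing k] {A A' B : Type*} [CommRing A] [Algebra k A] [CommRing A']
  [Algebra k A'] [CommRing B] [Algebra k B]

/-- The `k`-linear derivations of `A` with values in `B`, where `A` acts on `B` through `φ`.
Mathlib's `Derivation` would require an `A`-module structure on `B`, which depends on `φ`. -/
def derivationsAlong (φ : A →ₐ[k] B) : Submodule k (A →ₗ[k] B) where
  carrier := {D | ∀ x y, D (x * y) = φ x * D y + φ y * D x}
  zero_mem' := fun x y => by simp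
  add_mem' := fun {D D'} hD hD' x y => by
    simp only [LinearMap.add_apply, hD x y, hD' x y]
    ring
  smul_mem' := fun c D hD x y => by
    simp only [LinearMap.smul_apply, hD x y, smul_add, mul_smul_comm]

lemma comp_mem_derivationsAlong {φ : A →ₐ[k] B} {D : A →ₗ[k] B} (hD : D ∈ derivationsAlong φ)
    (f : A' →ₐ[k] A) : D ∘ₗ f.toLinearMap ∈ derivationsAlong (φ.comp f) := fun x y => by
  simpa using hD (f x) (f y)

lemma eq_zero_of_mem_adjoin_of_mem_derivationsAlong {φ : A →ₐ[k] B} {D : A →ₗ[k] B}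
    (hD : D ∈ derivationsAlong φ) {s : Set A} (hs : ∀ x ∈ s, D x = 0) {x : A}
    (hx : x ∈ Algebra.adjoin k s) : D x = 0 := by
  have hone : D 1 = 0 := by simpa using hD 1 1
  induction hx using Algebra.adjoin_induction with
  | mem x hx => exact hs x hx
  | algebraMap r => rw [Algebra.algebraMap_eq_smul_one, map_smul, hone, smul_zero]
  | add x y _ _ hx hy => rw [map_add, hx, hy, add_zero]
  | mul x y _ _ hx hy => rw [hD, hx, hy, mul_zero, mul_zero, add_zero]

end DerivationAlong

section Generators

variable {k : Type u} [CommRing k] {E : SimplicialObject (CommAlgCat.{v} k)}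

namespace ConstructionData

variable (X : ConstructionData.{u, v, z} E)

/-- The indices of the polynomial generators of `E_n`: the degeneracies `σ^* s` of the
generators `s`, where `σ` is a surjection from `[n]`. -/
abbrev Index (n : ℕ) : Type z := Σ m : ℕ, {f : ⦋n⦌ ⟶ ⦋m⦌ // Epi f} × X.gen m

/-- The polynomial generators `σ^* s` of `E_n`. -/
def basic (n : ℕ) (p : X.Index n) : Alg E n := pull E p.2.1.1 (X.elt p.1 p.2.2)

/-- A generator of dimension `n`, as a polynomial generator of `E_n`. -/
def index (n : ℕ) (s : X.gen n) : X.Index n := ⟨n, ⟨𝟙 _, inferInstance⟩, s⟩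

lemma basic_index (n : ℕ) (s : X.gen n) : X.basic n (X.index n s) = X.elt n s :=
  pull_id E _

lemma index_injective (n : ℕ) : Function.Injective (X.index n) := fun s t h => by
  simpa [index] using h

lemma lt_or_eq_index {n : ℕ} (p : X.Index n) : p.1 < n ∨ ∃ s, p = X.index n s := by
  obtain ⟨m, ⟨f, hf⟩, s⟩ := p
  rcases (SimplexCategory.len_le_of_epi f).lt_or_eq with hmn | rfl
  · exact .inl hmn
  · obtain rfl := SimplexCategory.eq_id_of_epi f
    exact .inr ⟨s, rfl⟩

lemma exists_pull_basic_eq {n l : ℕ} (e : ⦋n⦌ ⟶ ⦋l⦌) [Epi e] (p : X.Index l) :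
    ∃ q : X.Index n, q.1 ≤ l ∧ pull E e (X.basic l p) = X.basic n q := by
  obtain ⟨m, ⟨f, hf⟩, s⟩ := p
  exact ⟨⟨m, ⟨e ≫ f, epi_comp _ _⟩, s⟩, SimplexCategory.len_le_of_epi f, pull_comp E _ _ _⟩

/-- `E_n` as a polynomial algebra. -/
noncomputable def polyEquiv (n : ℕ) : MvPolynomial (X.Index n) k ≃ₐ[k] Alg E n :=
  AlgEquiv.ofBijective (MvPolynomial.aeval (X.basic n)) (X.free n)

lemma polyEquiv_X (n : ℕ) (p : X.Index n) : X.polyEquiv n (.X p) = X.basic n p :=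
  MvPolynomial.aeval_X _ _

lemma adjoin_basic (n : ℕ) : Algebra.adjoin k (Set.range (X.basic n)) = ⊤ := by
  rw [Algebra.adjoin_range_eq_range_aeval]
  exact AlgHom.range_eq_top _ |>.2 (X.free n).2

end ConstructionData

end Generators

section Coefficients

variable {k : Type u} [CommRing k] {E : SimplicialObject (CommAlgCat.{v} k)}
  {B : Type w} [CommRing B] [Algebra k B] {ε : Alg E 0 →ₐ[k] B}

namespace ConstructionData

variable (X : ConstructionData.{u, v, z} E)

variable (ε) in
/-- The augmentation of the partial derivative with respect to the generator `s`. -/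
noncomputable def coeff (n : ℕ) (s : X.gen n) : Alg E n →ₗ[k] B :=
  (aug ε n).toLinearMap ∘ₗ (X.polyEquiv n).toLinearMap ∘ₗ
    (MvPolynomial.pderiv (X.index n s)).toLinearMap ∘ₗ (X.polyEquiv n).symm.toLinearMap

lemma coeff_apply (n : ℕ) (s : X.gen n) (x : Alg E n) :
    X.coeff ε n s x = aug ε n (X.polyEquiv n
      (MvPolynomial.pderiv (X.index n s) ((X.polyEquiv n).symm x))) := rfl

lemma coeff_mem_derivationsAlong (n : ℕ) (s : X.gen n) :
    X.coeff ε n s ∈ derivationsAlong (aug ε n) := fun x y => by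
  simp only [coeff_apply, map_mul, Derivation.leibniz, smul_eq_mul, map_add,
    AlgEquiv.apply_symm_apply]

lemma coeff_basic_of_ne {n : ℕ} {s : X.gen n} {p : X.Index n} (h : p ≠ X.index n s) :
    X.coeff ε n s (X.basic n p) = 0 := by
  rw [coeff_apply, ← polyEquiv_X, AlgEquiv.symm_apply_apply, MvPolynomial.pderiv_X_of_ne h,
    map_zero, map_zero]

lemma coeff_elt_self (n : ℕ) (s : X.gen n) : X.coeff ε n s (X.elt n s) = 1 := by
  rw [coeff_apply, ← basic_index, ← polyEquiv_X, AlgEquiv.symm_apply_apply,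
    MvPolynomial.pderiv_X_self, map_one, map_one]

lemma coeff_elt_of_ne {n : ℕ} {s t : X.gen n} (h : t ≠ s) : X.coeff ε n s (X.elt n t) = 0 := by
  rw [← basic_index]
  exact X.coeff_basic_of_ne ((X.index_injective n).ne h)

lemma coeff_degen (n : ℕ) (s : X.gen (n + 1)) (i : Fin (n + 1)) (x : Alg E n) :
    X.coeff ε (n + 1) s (degen E n i x) = 0 := by
  refine eq_zero_of_mem_adjoin_of_mem_derivationsAlong
    (comp_mem_derivationsAlong (X.coeff_mem_derivationsAlong (n + 1) s) (degen E n i))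
    ?_ (X.adjoin_basic n ▸ Algebra.mem_top (x := x))
  rintro _ ⟨p, rfl⟩
  obtain ⟨q, hq, hpq⟩ := X.exists_pull_basic_eq (SimplexCategory.σ i) p
  refine (congrArg _ hpq).trans (X.coeff_basic_of_ne ?_)
  rintro rfl
  exact hq.not_gt n.lt_succ_self

lemma coeff_eq_zero_of_mem_degenerate {n : ℕ} (s : X.gen (n + 1)) {x : Alg E (n + 1)}
    (hx : x ∈ degenerate E (n + 1)) : X.coeff ε (n + 1) s x = 0 := by
  refine eq_zero_of_mem_adjoin_of_mem_derivationsAlong (X.coeff_mem_derivationsAlong _ s) ?_ hx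
  rintro _ ⟨i, y, rfl⟩
  exact X.coeff_degen n s i y

variable (ε) in
/-- The alternating sum of the `coeff` functionals of all the faces. -/
noncomputable def altCoeff (n : ℕ) (s : X.gen n) : Alg E (n + 1) →ₗ[k] B :=
  ∑ j : Fin (n + 2), (-1 : k) ^ (j : ℕ) • (X.coeff ε n s ∘ₗ (face E n j).toLinearMap)

lemma altCoeff_apply (n : ℕ) (s : X.gen n) (x : Alg E (n + 1)) :
    X.altCoeff ε n s x = ∑ j : Fin (n + 2), (-1 : k) ^ (j : ℕ) • X.coeff ε n s (face E n j x) := by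
  simp [altCoeff]

lemma altCoeff_mem_derivationsAlong (hε : IsPiZero E ε) (n : ℕ) (s : X.gen n) :
    X.altCoeff ε n s ∈ derivationsAlong (aug ε (n + 1)) := by
  refine sum_mem fun j _ => Submodule.smul_mem _ _ ?_
  have hface : (aug ε n).comp (face E n j) = aug ε (n + 1) := AlgHom.ext (hε.aug_face n j)
  exact hface ▸ comp_mem_derivationsAlong (X.coeff_mem_derivationsAlong n s) (face E n j)

/-- Of the faces of `s_i x` all but `d_i` and `d_{i+1}` are degenerate, and those two cancel. -/
lemma altCoeff_degen (n : ℕ) (s : X.gen (n + 1)) (i : Fin (n + 2)) (x : Alg E (n + 1)) :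
    X.altCoeff ε (n + 1) s (degen E (n + 1) i x) = 0 := by
  rw [altCoeff_apply, Fintype.sum_eq_add i.castSucc i.succ Fin.castSucc_lt_succ.ne
    fun j hj => by
      rw [X.coeff_eq_zero_of_mem_degenerate s (face_degen_mem_degenerate hj.1 hj.2 x), smul_zero],
    face_degen_self, face_degen_succ, Fin.val_castSucc, Fin.val_succ, ← add_smul, pow_succ]
  simp

lemma altCoeff_eq_zero_of_mem_degenerate (hε : IsPiZero E ε) {n : ℕ} (s : X.gen (n + 1))
    {x : Alg E (n + 2)} (hx : x ∈ degenerate E (n + 2)) : X.altCoeff ε (n + 1) s x = 0 := by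
  refine eq_zero_of_mem_adjoin_of_mem_derivationsAlong
    (X.altCoeff_mem_derivationsAlong hε (n + 1) s) ?_ hx
  rintro _ ⟨i, y, rfl⟩
  exact X.altCoeff_degen n s i y

lemma altCoeff_of_mem_moore {n : ℕ} (s : X.gen n) {x : Alg E (n + 1)} (hx : x ∈ moore E (n + 1)) :
    X.altCoeff ε n s x = (-1 : k) ^ (n + 1) • X.coeff ε n s (lastFace E n x) := by
  simp [altCoeff_apply, Fin.sum_univ_castSucc, mem_moore_succ.1 hx, lastFace]

theorem coeff_eq_zero_of_mem_crossedRelations (hε : IsPiZero E ε) {n : ℕ} (s : X.gen (n + 1))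
    {x : Alg E (n + 1)} (hx : x ∈ crossedRelations E (n + 1)) : X.coeff ε (n + 1) s x = 0 := by
  suffices crossedRelations E (n + 1) ≤ LinearMap.ker (X.coeff ε (n + 1) s) from this hx
  refine sup_le (fun y hy => X.coeff_eq_zero_of_mem_degenerate s hy.2) ?_
  rintro _ ⟨y, ⟨hy, hyD⟩, rfl⟩
  have hunit : IsUnit ((-1 : k) ^ (n + 2)) := isUnit_one.neg.pow _
  rw [LinearMap.mem_ker, ← hunit.smul_eq_zero]
  exact (X.altCoeff_of_mem_moore s hy).symm.trans (X.altCoeff_eq_zero_of_mem_degenerate hε s hyD)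

lemma coeff_totalDegen_mul (hε : IsPiZero E ε) {n : ℕ} (s : X.gen (n + 1)) (r : Alg E 0)
    {x : Alg E (n + 1)} (hx : x ∈ moore E (n + 1)) :
    X.coeff ε (n + 1) s (totalDegen E (n + 1) r * x) = ε r * X.coeff ε (n + 1) s x := by
  rw [X.coeff_mem_derivationsAlong (n + 1) s, hε.aug_totalDegen, hε.aug_eq_zero_of_mem_moore hx,
    zero_mul, add_zero]

end ConstructionData

end Coefficients

section TermModule

variable {k : Type u} [CommRing k] {E : SimplicialObject (CommAlgCat.{v} k)}

lemma totalDegen_mem_degenerate (n : ℕ) (r : Alg E 0) :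
    totalDegen E (n + 1) r ∈ degenerate E (n + 1) :=
  pull_mem_degenerate n.succ_pos _ r

lemma totalDegen_mul_mem_mooreModule_inf_degenerate (n : ℕ) (r : Alg E 0) {x : Alg E (n + 1)}
    (hx : x ∈ mooreModule E (n + 1) ⊓ Subalgebra.toSubmodule (degenerate E (n + 1))) :
    totalDegen E (n + 1) r * x ∈
      mooreModule E (n + 1) ⊓ Subalgebra.toSubmodule (degenerate E (n + 1)) :=
  ⟨Ideal.mul_mem_left _ _ hx.1,
    (degenerate E (n + 1)).mul_mem (totalDegen_mem_degenerate n r) hx.2⟩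

lemma lastFace_totalDegen (n : ℕ) (r : Alg E 0) :
    lastFace E n (totalDegen E (n + 1) r) = totalDegen E n r :=
  pull_comp E (SimplexCategory.δ (Fin.last (n + 1))) _ r

lemma totalDegen_mul_mem_degenerateBoundary {n : ℕ} (r : Alg E 0) {x : Alg E n}
    (hx : x ∈ degenerateBoundary E n) : totalDegen E n r * x ∈ degenerateBoundary E n := by
  obtain ⟨y, hy, rfl⟩ := hx
  refine ⟨_, totalDegen_mul_mem_mooreModule_inf_degenerate n r hy, ?_⟩
  rw [AlgHom.toLinearMap_apply, map_mul, lastFace_totalDegen, AlgHom.toLinearMap_apply]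

lemma totalDegen_mul_mem_relations {n : ℕ} (r : Alg E 0) {x : Alg E n}
    (hx : x ∈ relations E n) : totalDegen E n r * x ∈ relations E n := by
  obtain _ | _ | _ | n := n
  · exact (Submodule.mem_bot k).2 (by rw [(Submodule.mem_bot k).1 hx, mul_zero])
  · exact (Submodule.mem_bot k).2 (by rw [(Submodule.mem_bot k).1 hx, mul_zero])
  · exact totalDegen_mul_mem_degenerateBoundary r hx
  · obtain ⟨y, hy, z, hz, rfl⟩ := Submodule.mem_sup.1 hx
    rw [mul_add]
    exact add_mem
      (Submodule.mem_sup_left (totalDegen_mul_mem_mooreModule_inf_degenerate _ r hy))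
      (Submodule.mem_sup_right (totalDegen_mul_mem_degenerateBoundary r hz))

lemma termMk_surjective (n : ℕ) : Function.Surjective (termMk E n) :=
  Submodule.mkQ_surjective ((relations E n).comap (mooreModule E n).subtype)

lemma termMk_eq_zero {n : ℕ} (hn : 3 ≤ n) {x : moore E n} :
    termMk E n x = 0 ↔ x.1 ∈ crossedRelations E n := by
  rw [← relations_eq_crossedRelations E hn]
  exact Submodule.Quotient.mk_eq_zero _

variable (E) in
/-- The action of `E_0` on the `n`-th term of the 2-crossed complex. -/
def termAction (n : ℕ) : Alg E 0 →+* Module.End k (TwoCrossedTerm E n) where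
  toFun r := Submodule.mapQ _ _ (Algebra.lsmul k k (moore E n) (totalDegen E n r))
    fun _ hx => totalDegen_mul_mem_relations r hx
  map_one' := LinearMap.ext <| (termMk_surjective n).forall.2 fun x =>
    congrArg (termMk E n) <| Subtype.ext <| show totalDegen E n 1 * x.1 = x.1 by
      rw [map_one, one_mul]
  map_zero' := LinearMap.ext <| (termMk_surjective n).forall.2 fun x =>
    congrArg (termMk E n) <| Subtype.ext <| show totalDegen E n 0 * x.1 = 0 by
      rw [map_zero, zero_mul]
  map_add' r r' := LinearMap.ext <| (termMk_surjective n).forall.2 fun x =>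
    congrArg (termMk E n) <| Subtype.ext <|
      show totalDegen E n (r + r') * x.1 = totalDegen E n r * x.1 + totalDegen E n r' * x.1 by
        rw [map_add, add_mul]
  map_mul' r r' := LinearMap.ext <| (termMk_surjective n).forall.2 fun x =>
    congrArg (termMk E n) <| Subtype.ext <|
      show totalDegen E n (r * r') * x.1 = totalDegen E n r * (totalDegen E n r' * x.1) by
        rw [map_mul, mul_assoc]

variable {B : Type w} [CommRing B] [Algebra k B] {ε : Alg E 0 →ₐ[k] B}

lemma ker_le_ker_termAction (hε : IsPiZero E ε) {n : ℕ} (hn : 3 ≤ n) :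
    RingHom.ker (ε : Alg E 0 →+* B) ≤ RingHom.ker (termAction E n) := by
  intro r hr
  obtain ⟨y, hy, rfl⟩ := (hε.ker_eq r).1 hr
  obtain ⟨n, rfl⟩ := Nat.exists_eq_add_of_le' hn
  refine LinearMap.ext fun t => ?_
  obtain ⟨x, rfl⟩ := termMk_surjective _ t
  exact (termMk_eq_zero hn).2 (totalDegen_lastFace_mul_mem_crossedRelations (n := n + 1) hy x.2)

/-- The `B`-module structure induced through `ε` on the `n`-th term of the 2-crossed complex. -/
noncomputable abbrev termModule (hε : IsPiZero E ε) {n : ℕ} (hn : 3 ≤ n) :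
    Module B (TwoCrossedTerm E n) :=
  Module.compHom _ (RingHom.liftOfSurjective (ε : Alg E 0 →+* B) hε.surjective
    ⟨termAction E n, ker_le_ker_termAction hε hn⟩)

lemma termModule_smul_termMk (hε : IsPiZero E ε) {n : ℕ} (hn : 3 ≤ n) (r : Alg E 0)
    (x : moore E n) : letI := termModule hε hn
    ε r • termMk E n x = termMk E n (mooreAct E n r x) :=
  congr($(RingHom.liftOfSurjective_comp_apply (ε : Alg E 0 →+* B) hε.surjective
    ⟨termAction E n, ker_le_ker_termAction hε hn⟩ r) (termMk E n x))

end TermModule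

section Basis

lemma exists_mem_sub_mem_span_of_adjoin_eq_top {k R : Type*} [CommRing k] [CommRing R]
    [Algebra k R] {A : Subalgebra k R} {s : Set R} (h : Algebra.adjoin k (A ∪ s) = ⊤) (x : R) :
    ∃ a ∈ A, x - a ∈ Ideal.span s := by
  let π := Ideal.Quotient.mkₐ k (Ideal.span s)
  suffices Algebra.adjoin k (A ∪ s) ≤ (A.map π).comap π by
    obtain ⟨a, ha, hax⟩ := this (h ▸ Algebra.mem_top (x := x))
    exact ⟨a, ha, Ideal.Quotient.eq.1 hax.symm⟩
  refine Algebra.adjoin_le (Set.union_subset (fun a ha => ⟨a, ha, rfl⟩) fun a ha => ?_)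
  exact ⟨0, A.zero_mem, (map_zero π).trans
    (Ideal.Quotient.eq_zero_iff_mem.2 (Ideal.subset_span ha)).symm⟩

variable {k : Type u} [CommRing k] {E : SimplicialObject (CommAlgCat.{v} k)}
  {B : Type w} [CommRing B] [Algebra k B] {ε : Alg E 0 →ₐ[k] B}

lemma termMk_smul {n : ℕ} (hn : 3 ≤ n) (e : Alg E n) (x : moore E n) :
    termMk E n (e • x) = termMk E n (mooreAct E n (vertex E n e) x) := by
  obtain ⟨n, rfl⟩ := Nat.exists_eq_add_of_le' hn
  refine sub_eq_zero.1 ((termMk_eq_zero hn).2 ?_)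
  have h := sub_totalDegen_vertex_mul_mem_crossedRelations e x.2
  rwa [sub_mul] at h

namespace ConstructionData

variable (X : ConstructionData.{u, v, z} E)

lemma adjoin_degenerate_union_range_elt (n : ℕ) :
    Algebra.adjoin k ((degenerate E n : Set (Alg E n)) ∪ Set.range (X.elt n)) = ⊤ := by
  rw [eq_top_iff, ← X.adjoin_basic n]
  refine Algebra.adjoin_mono ?_
  rintro _ ⟨p, rfl⟩
  obtain hp | ⟨s, rfl⟩ := X.lt_or_eq_index p
  · exact .inl (pull_mem_degenerate hp _ _)
  · exact .inr ⟨s, (X.basic_index n s).symm⟩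

lemma exists_mem_span_termMk_eq {n : ℕ} (hn : 3 ≤ n) (x : moore E n) :
    ∃ y : moore E n, y.1 ∈ Ideal.span (Set.range (X.elt n)) ∧ termMk E n y = termMk E n x := by
  obtain ⟨d, hd, hxd⟩ := exists_mem_sub_mem_span_of_adjoin_eq_top
    (X.adjoin_degenerate_union_range_elt n) x.1
  have hspan : Ideal.span (Set.range (X.elt n)) ≤ moore E n :=
    Ideal.span_le.2 (Set.range_subset_iff.2 (X.elt_mem_moore n))
  have hd_moore : d ∈ moore E n := by
    simpa using sub_mem x.2 (hspan hxd)
  refine ⟨⟨x.1 - d, hspan hxd⟩, hxd, (sub_eq_zero.1 ((termMk_eq_zero hn).2 ?_)).symm⟩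
  have hsub : x.1 - (x.1 - d) ∈ crossedRelations E n := by
    rw [sub_sub_cancel]
    exact mem_crossedRelations_of_mem_degenerate hd_moore hd
  exact hsub

section

variable {n : ℕ} [Module B (TwoCrossedTerm E n)]
  (hsmul : ∀ r x, ε r • termMk E n x = termMk E n (mooreAct E n r x))
include hsmul

theorem span_range_termMk_mooreElt (hn : 3 ≤ n) :
    ⊤ ≤ Submodule.span B (Set.range fun s => termMk E n (X.mooreElt n s)) := by
  have hspan (y : Alg E n) (hy : y ∈ Ideal.span (Set.range (X.elt n))) : ∃ hy' : y ∈ moore E n,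
      termMk E n ⟨y, hy'⟩ ∈ Submodule.span B (Set.range fun s => termMk E n (X.mooreElt n s)) := by
    induction hy using Submodule.span_induction with
    | mem y hy =>
      obtain ⟨s, rfl⟩ := hy
      exact ⟨X.elt_mem_moore n s, Submodule.subset_span ⟨s, rfl⟩⟩
    | zero => exact ⟨zero_mem _, zero_mem _⟩
    | add y y' _ _ hy hy' =>
      obtain ⟨⟨hy, hyspan⟩, hy', hyspan'⟩ := hy, hy'
      exact ⟨add_mem hy hy', add_mem hyspan hyspan'⟩
    | smul e y _ hy =>
      obtain ⟨hy, hyspan⟩ := hy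
      refine ⟨Ideal.mul_mem_left _ e hy, ?_⟩
      have := termMk_smul hn e ⟨y, hy⟩
      rw [← hsmul] at this
      exact this ▸ Submodule.smul_mem _ _ hyspan
  intro t _
  obtain ⟨x, rfl⟩ := termMk_surjective _ t
  obtain ⟨y, hy, hyx⟩ := X.exists_mem_span_termMk_eq hn x
  obtain ⟨_, hyspan⟩ := hspan y hy
  exact hyx ▸ hyspan

lemma exists_dual_termMk (hε : IsPiZero E ε) (hn : 3 ≤ n) (s : X.gen n) :
    ∃ φ : TwoCrossedTerm E n →ₗ[B] B, ∀ x, φ (termMk E n x) = X.coeff ε n s x.1 := by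
  obtain ⟨n, rfl⟩ := Nat.exists_eq_add_of_le' hn
  let φ : TwoCrossedTerm E (n + 3) →ₗ[k] B :=
    Submodule.liftQ _ (X.coeff ε (n + 3) s ∘ₗ (mooreModule E (n + 3)).subtype) fun x hx =>
      X.coeff_eq_zero_of_mem_crossedRelations hε s hx
  refine ⟨{ φ with map_smul' := fun b t => ?_ }, fun _ => rfl⟩
  obtain ⟨r, rfl⟩ := hε.surjective b
  obtain ⟨x, rfl⟩ := termMk_surjective _ t
  change φ (ε r • termMk E (n + 3) x) = ε r * φ (termMk E (n + 3) x)
  rw [hsmul]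
  exact X.coeff_totalDegen_mul hε s r x.2

theorem linearIndependent_termMk_mooreElt (hε : IsPiZero E ε) (hn : 3 ≤ n) :
    LinearIndependent B fun s => termMk E n (X.mooreElt n s) := by
  choose φ hφ using X.exists_dual_termMk hsmul hε hn
  exact .of_pairwise_dual_eq_zero_one _ φ
    (fun s t hst => (hφ s _).trans (X.coeff_elt_of_ne hst.symm))
    fun s => (hφ s _).trans (X.coeff_elt_self n s)

end

theorem isFreeTermOn {n : ℕ} (hε : IsPiZero E ε) (hn : 3 ≤ n) :
    IsFreeTermOn E ε n (X.mooreElt n) := by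
  let := termModule hε hn
  have hsmul := termModule_smul_termMk hε hn
  exact ⟨this, hsmul, .mk (X.linearIndependent_termMk_mooreElt hsmul hε hn)
    (X.span_range_termMk_mooreElt hsmul hn), fun s => Module.Basis.mk_apply _ _ s⟩

end ConstructionData

end Basis

section Skeleton

variable {k : Type u} [CommRing k] {E : SimplicialObject (CommAlgCat.{v} k)}

lemma skelIncl_injective (m n : ℕ) : Function.Injective (skelIncl E m n) :=
  Subtype.val_injective

lemma skelIncl_face (m n : ℕ) (i : Fin (n + 2)) (x : Alg (skel E m) (n + 1)) :
    skelIncl E m n (face (skel E m) n i x) = face E n i (skelIncl E m (n + 1) x) := rfl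

lemma skelIncl_mem_moore {m n : ℕ} {x : Alg (skel E m) n} :
    skelIncl E m n x ∈ moore E n ↔ x ∈ moore (skel E m) n := by
  cases n with
  | zero => exact iff_of_true Submodule.mem_top Submodule.mem_top
  | succ n =>
    rw [mem_moore_succ, mem_moore_succ]
    simp only [← skelIncl_face, map_eq_zero_iff _ (skelIncl_injective m n)]

lemma skelIncl_surjective {m n : ℕ} (h : n ≤ m) : Function.Surjective (skelIncl E m n) :=
  fun x => ⟨⟨x, Algebra.subset_adjoin ⟨n, h, 𝟙 _, x, (pull_id E x).symm⟩⟩, rfl⟩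

lemma IsPiZero.skel {B : Type w} [CommRing B] [Algebra k B] {ε : Alg E 0 →ₐ[k] B}
    (hε : IsPiZero E ε) {m : ℕ} (hm : 1 ≤ m) : IsPiZero (skel E m) (ε.comp (skelIncl E m 0)) where
  surjective := hε.surjective.comp (skelIncl_surjective (Nat.zero_le m))
  ker_eq r := by
    rw [AlgHom.comp_apply, hε.ker_eq, (skelIncl_surjective hm).exists]
    simp only [lastFace, ← skelIncl_face, (skelIncl_injective m 0).eq_iff, skelIncl_mem_moore]

namespace ConstructionData

variable (X : ConstructionData.{u, v, z} E)

lemma skelAlg_le_adjoin_basic (m n : ℕ) :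
    skelAlg E m n ≤ Algebra.adjoin k (X.basic n '' {p | p.1 ≤ m}) := by
  refine Algebra.adjoin_le ?_
  rintro _ ⟨j, hj, f, y, rfl⟩
  obtain ⟨l, hlj, e, he, g, rfl⟩ : ∃ l ≤ j, ∃ (e : ⦋n⦌ ⟶ ⦋l⦌) (_ : Epi e) (g : ⦋l⦌ ⟶ ⦋j⦌),
      e ≫ g = f :=
    ⟨_, SimplexCategory.len_le_of_mono (Limits.image.ι f), Limits.factorThruImage f,
      inferInstance, Limits.image.ι f, Limits.image.fac f⟩
  suffices ⊤ ≤ (Algebra.adjoin k (X.basic n '' {p | p.1 ≤ m})).comap (pull E e) by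
    rw [← pull_comp]
    exact this Algebra.mem_top
  rw [← X.adjoin_basic l, Algebra.adjoin_le_iff]
  rintro _ ⟨p, rfl⟩
  obtain ⟨q, hq, hpq⟩ := X.exists_pull_basic_eq e p
  exact Algebra.subset_adjoin ⟨q, (hq.trans hlj).trans hj, hpq.symm⟩

/-- The indices of the polynomial generators of the `n`-simplices of the `m`-skeleton. -/
abbrev SkelIndex (m n : ℕ) : Type z :=
  Σ l : ℕ, {f : ⦋n⦌ ⟶ ⦋l⦌ // Epi f} × {_s : X.gen l // l ≤ m}

variable {X} in
/-- The inclusion of the polynomial generators of the skeleton. -/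
def SkelIndex.incl {m n : ℕ} (p : X.SkelIndex m n) : X.Index n := ⟨p.1, p.2.1, p.2.2.1⟩

lemma SkelIndex.incl_injective (m n : ℕ) :
    Function.Injective (SkelIndex.incl : X.SkelIndex m n → X.Index n) := by
  rintro ⟨l, f, s⟩ ⟨l', f', s'⟩ h
  obtain ⟨rfl, h⟩ := Sigma.mk.inj h
  obtain ⟨rfl, h⟩ := Prod.mk.inj (eq_of_heq h)
  obtain rfl : s = s' := Subtype.ext h
  rfl

/-- The polynomial generators of the `n`-simplices of the `m`-skeleton. -/
def skelBasic (m n : ℕ) (p : X.SkelIndex m n) : Alg (SimplicialAlgebra.skel E m) n :=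
  pull (SimplicialAlgebra.skel E m) p.2.1.1 (X.skelElt m p.1 p.2.2).1

lemma skelIncl_skelBasic {m n : ℕ} (p : X.SkelIndex m n) :
    skelIncl E m n (X.skelBasic m n p) = X.basic n p.incl := rfl

lemma skelIncl_comp_aeval_skelBasic (m n : ℕ) :
    (skelIncl E m n).comp (MvPolynomial.aeval (X.skelBasic m n)) =
      (MvPolynomial.aeval (X.basic n)).comp (MvPolynomial.rename SkelIndex.incl) :=
  MvPolynomial.algHom_ext fun p => by
    simp only [AlgHom.comp_apply, MvPolynomial.aeval_X, MvPolynomial.rename_X, skelIncl_skelBasic]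

lemma aeval_skelBasic_injective (m n : ℕ) :
    Function.Injective (MvPolynomial.aeval (R := k) (X.skelBasic m n)) := by
  refine Function.Injective.of_comp (f := skelIncl E m n) ?_
  rw [← AlgHom.coe_comp, skelIncl_comp_aeval_skelBasic, AlgHom.coe_comp]
  exact (X.free n).1.comp (MvPolynomial.rename_injective _ (SkelIndex.incl_injective X m n))

lemma aeval_skelBasic_surjective (m n : ℕ) :
    Function.Surjective (MvPolynomial.aeval (R := k) (X.skelBasic m n)) := by
  intro x
  have hle : Algebra.adjoin k (X.basic n '' {p | p.1 ≤ m}) ≤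
      ((skelIncl E m n).comp (MvPolynomial.aeval (X.skelBasic m n))).range := by
    refine Algebra.adjoin_le ?_
    rintro _ ⟨⟨l, f, s⟩, hl, rfl⟩
    exact ⟨.X ⟨l, f, s, hl⟩, congrArg (skelIncl E m n) (MvPolynomial.aeval_X _ _)⟩
  obtain ⟨P, hP⟩ := hle (X.skelAlg_le_adjoin_basic m n x.2)
  exact ⟨P, skelIncl_injective m n hP⟩

/-- The skeleton is itself free, on the generators of dimension at most `m`. -/
def skel (m : ℕ) : ConstructionData.{u, v, z} (skel E m) where
  gen n := {_s : X.gen n // n ≤ m}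
  elt n s := (X.skelElt m n s).1
  face_elt n s := mem_moore_succ.1 (X.skelElt m (n + 1) s).2
  free n := ⟨X.aeval_skelBasic_injective m n, X.aeval_skelBasic_surjective m n⟩

end ConstructionData

end Skeleton

end SimplicialAlgebra

theorem mainTheorem9_general {k : Type u} [CommRing k] {B : Type w} [CommRing B] [Algebra k B]
    (E : SimplicialObject (CommAlgCat.{v} k))
    (X : SimplicialAlgebra.ConstructionData.{u, v, z} E)
    (ε : SimplicialAlgebra.Alg E 0 →ₐ[k] B) (hε : SimplicialAlgebra.IsPiZero E ε)
    (n : ℕ) (hn : 3 ≤ n) :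
    (∀ m : ℕ, 1 ≤ m →
      SimplicialAlgebra.IsFreeTermOn (SimplicialAlgebra.skel E m)
        (ε.comp (SimplicialAlgebra.skelIncl E m 0)) n (X.skelElt m n)) ∧
    SimplicialAlgebra.IsFreeTermOn E ε n (X.mooreElt n) :=
  ⟨fun m hm => (X.skel m).isFreeTermOn (hε.skel hm) hn, X.isFreeTermOn hε hn⟩

theorem mainTheorem9 {k : Type u} [CommRing k] {B : Type w} [CommRing B] [Algebra k B]
    (E : SimplicialObject (CommAlgCat.{v} k))
    (X : SimplicialAlgebra.ConstructionData.{u, v, z} E)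
    (ε : SimplicialAlgebra.Alg E 0 →ₐ[k] B) (hE : SimplicialAlgebra.IsResolution E ε)
    (n : ℕ) (hn : 3 ≤ n) :
    (∀ m : ℕ, 1 ≤ m →
      SimplicialAlgebra.IsFreeTermOn (SimplicialAlgebra.skel E m)
        (ε.comp (SimplicialAlgebra.skelIncl E m 0)) n (X.skelElt m n)) ∧
    SimplicialAlgebra.IsFreeTermOn E ε n (X.mooreElt n) :=
  mainTheorem9_general E X ε hE.isPiZero n hn
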